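/- For a prime $p$, a linear code $C\subseteq(\mathbb Z/p\mathbb Z)^n$ and a real $a>0$, call $\Lambda=a\Lambda_C=\{a v : v\in\mathbb Z^n,\ v \bmod p\in C\}\subset\mathbb R^n$ a (scaled) mod-$p$ (Construction A) lattice. For a lattice $\Lambda\subset\mathbb R^n$ of fundamental volume $V(\Lambda)$ and $\sigma>0$ let $$f_{\sigma,\Lambda}(x)=\frac1{(\sqrt{2\pi}\,\sigma)^n}\sum_{\lambda\in\Lambda}e^{-\|x-\lambda\|^2/(2\sigma^2)},\qquad \epsilon_\Lambda(\sigma)=\max_{x\in\mathcal R(\Lambda)}\left|V(\Lambda)f_{\sigma,\Lambda}(x)-1\right|,\qquad \gamma_\Lambda(\sigma)=\frac{V(\Lambda)^{2/n}}{\sigma^2},$$ where $\mathcal R(\Lambda)$ is any fundamental region of $\Lambda$ (by periodicity the maximum may be taken over $\mathbb R^n$); $\epsilon_\Lambda(\sigma)$ is the flatness factor and $\gamma_\Lambda(\sigma)$ the volume-to-noise ratio (VNR). **Theorem.** Let $\sigma>0$, $\delta>0$, and let $(\gamma_n)_{n\ge2}$ be any sequence of positive reals (prescribed VNRs, for instance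 a constant sequence). 1. There is a sequence of mod-$p$ lattices $\Lambda^{(n)}\subset\mathbb R^n$, $n\ge2$ ($p$, $C$ and $a$ may depend on $n$), with $\gamma_{\Lambda^{(n)}}(\sigma)=\gamma_n$ and $$\epsilon_{\Lambda^{(n)}}(\sigma)\le(1+\delta)\left(\frac{\gamma_{\Lambda^{(n)}}(\sigma)}{2\pi}\right)^{n/2}\qquad\text{for all } n\ge2,$$ and such that, if $\gamma_n\le g$ for all large $n$ with some constant $g<2\pi$ (in particular if $\gamma_n$ is a constant smaller than $2\pi$), then $\epsilon_{\Lambda^{(n)}}(\sigma)\to0$ exponentially: $\epsilon_{\Lambda^{(n)}}(\sigma)=O(e^{-cn})$ for some $c>0$. 2. There is a sequence of mod-$p$ lattices $\Lambda'^{(n)}\subset\mathbb R^n$, $n\ge2$, with $\gamma_{\Lambda'^{(n)}}(\sigma)=\gamma_n$ and $$\epsilon_{\Lambda'^{(n)}}(\sigma)\ge(1-\delta)\left(\frac{\gamma_{\Lambda'^{(n)}}(\sigma)}{2\pi}\right)^{n/2}\qquad\text{for all } n\ge2,$$ and such that, if $\gamma_n\ge g$ for all large $n$ with some constant $g>2\pi$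 (in particular if $\gamma_n$ is a constant larger than $2\pi$), then $\epsilon_{\Lambda'^{(n)}}(\sigma)\to\infty$ exponentially: $e^{cn}=O(\epsilon_{\Lambda'^{(n)}}(\sigma))$ for some $c>0$. -/

import Mathlib

open Filter Topology MeasureTheory Asymptotics

/-- The scaled mod-`p` (Construction A) lattice `a Λ_C = {a v : v ∈ ℤⁿ, v mod p ∈ C}` in Euclidean
space, for a linear code `C` of block length `n` over `ℤ/pℤ`. -/
def constructionA {n : ℕ} (p : ℕ) (C : Submodule (ZMod p) (Fin n → ZMod p)) (a : ℝ) :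
    Submodule ℤ (EuclideanSpace ℝ (Fin n)) where
  carrier := {x | ∃ v : Fin n → ℤ, (fun i => (v i : ZMod p)) ∈ C ∧ ∀ i, x i = a * (v i : ℝ)}
  zero_mem' := by
    refine ⟨0, ?_, by simp⟩
    convert C.zero_mem using 1
    ext i
    simp
  add_mem' := by
    rintro x y ⟨v, hv, hx⟩ ⟨w, hw, hy⟩
    refine ⟨v + w, ?_, fun i => ?_⟩
    · simpa [Pi.add_def] using C.add_mem hv hw
    · simp [hx i, hy i, mul_add]
  smul_mem' := by
    rintro m x ⟨v, hv, hx⟩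
    refine ⟨m • v, ?_, fun i => ?_⟩
    · simpa [Pi.smul_def] using C.smul_mem (m : ZMod p) hv
    · simp [hx i, mul_left_comm]

/-- `Λ` is a (scaled) mod-`p` lattice: `Λ = a Λ_C` for a prime `p`, a linear code `C` over `ℤ/pℤ`
and a scale `a > 0`. -/
def IsModPLattice {n : ℕ} (Λ : Submodule ℤ (EuclideanSpace ℝ (Fin n))) : Prop :=
  ∃ (p : ℕ) (C : Submodule (ZMod p) (Fin n → ZMod p)) (a : ℝ),
    p.Prime ∧ 0 < a ∧ Λ = constructionA p C a

/-- The Gaussian density `f_{σ,c}` on `ℝⁿ` of variance `σ²` per dimension, centered at `c`. -/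
noncomputable def gaussianDensity {n : ℕ} (σ : ℝ) (c x : EuclideanSpace ℝ (Fin n)) : ℝ :=
  1 / (Real.sqrt (2 * Real.pi) * σ) ^ n * Real.exp (-‖x - c‖ ^ 2 / (2 * σ ^ 2))

/-- The `Λ`-periodic function `f_{σ,Λ}(x) = ∑_{λ ∈ Λ} f_{σ,λ}(x)`. -/
noncomputable def latticeGaussian {n : ℕ} (Λ : Submodule ℤ (EuclideanSpace ℝ (Fin n))) (σ : ℝ)
    (x : EuclideanSpace ℝ (Fin n)) : ℝ :=
  ∑' l : Λ, gaussianDensity σ (l : EuclideanSpace ℝ (Fin n)) x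

/-- The flatness factor `ε_Λ(σ)`: the supremum of `|V(Λ) f_{σ,Λ}(x) - 1|`. As `f_{σ,Λ}` is
`Λ`-periodic, the supremum over all of `ℝⁿ` is the one over any fundamental region
(`flatnessFactor_eq_sSup_image`). -/
noncomputable def flatnessFactor {n : ℕ} (Λ : Submodule ℤ (EuclideanSpace ℝ (Fin n)))
    (σ : ℝ) : ℝ :=
  ⨆ x : EuclideanSpace ℝ (Fin n), |ZLattice.covolume Λ * latticeGaussian Λ σ x - 1|

/-- The volume-to-noise ratio `γ_Λ(σ) = V(Λ)^{2/n} / σ²`. -/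
noncomputable def vnr {n : ℕ} (Λ : Submodule ℤ (EuclideanSpace ℝ (Fin n))) (σ : ℝ) : ℝ :=
  ZLattice.covolume Λ ^ (2 / (n : ℝ)) / σ ^ 2

theorem latticeGaussian_sub {n : ℕ} (Λ : Submodule ℤ (EuclideanSpace ℝ (Fin n))) (σ : ℝ)
    (x : EuclideanSpace ℝ (Fin n)) (l : Λ) :
    latticeGaussian Λ σ (x - l) = latticeGaussian Λ σ x := by
  unfold latticeGaussian
  rw [← (Equiv.subRight l).tsum_eq]
  refine tsum_congr fun m => ?_
  simp [gaussianDensity]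

/-- The flatness factor may be computed on any set `R` whose `Λ`-translates cover `ℝⁿ`, in
particular on any fundamental region of `Λ`. -/
theorem flatnessFactor_eq_sSup_image {n : ℕ} (Λ : Submodule ℤ (EuclideanSpace ℝ (Fin n))) (σ : ℝ)
    (R : Set (EuclideanSpace ℝ (Fin n)))
    (hR : ∀ x : EuclideanSpace ℝ (Fin n), ∃ l : Λ, x - (l : EuclideanSpace ℝ (Fin n)) ∈ R) :
    flatnessFactor Λ σ =
      sSup ((fun x => |ZLattice.covolume Λ * latticeGaussian Λ σ x - 1|) '' R) := by
  unfold flatnessFactor iSup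
  congr 1
  ext y
  constructor
  · rintro ⟨x, rfl⟩
    obtain ⟨l, hl⟩ := hR x
    exact ⟨x - l, hl, by simp only [latticeGaussian_sub]⟩
  · rintro ⟨x, -, rfl⟩
    exact ⟨x, rfl⟩

/-! The proof averages over codes with a single parity check. For `u ≠ 0` modulo a prime `p`, the
lattice of all `a v` with `u · v ≡ 0` has volume `aⁿ p` and dual `a⁻¹(ℤⁿ + ℤ u/p)`. Poisson
summation writes `V f` as a series of characters over this dual with positive Gaussian coefficients,
the constant term being 1. Hence `|V f - 1|` is largest at the origin, and the flatness factor is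
exactly the Gaussian theta series of the dual minus 1 (`flatnessFactor_parityCode`).

For `t ≠ 0` the vector `t u` runs over all nonzero residue vectors when `u` does, so the mean of the
flatness factor over `u ≠ 0` is explicit in two one-dimensional theta values
(`sum_flatnessFactor_parityCode`). With `V = aⁿ p` fixed and `p → ∞`, the mean becomes a Riemann sum
of a Gaussian and tends to `V / (√(2π) σ)ⁿ = (γ/2π)^(n/2)` (`tendsto_meanFlatness`). For a large
prime, some `u` lies at or below the mean and some `u` at or above it, which gives the two halves of
the theorem; the exponential rates are those of `(γ/2π)^(n/2)`. -/

/-! ### One-dimensional theta series and Poisson summation -/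

/-- The one-dimensional Gaussian theta series `∑_{k ∈ ℤ} exp(-κ (k - s)²)`. -/
noncomputable def gaussianTheta (κ s : ℝ) : ℝ := ∑' k : ℤ, Real.exp (-κ * (k - s) ^ 2)

theorem summable_exp_neg_mul_int_sub_sq {κ : ℝ} (hκ : 0 < κ) (s : ℝ) :
    Summable fun k : ℤ => Real.exp (-κ * (k - s) ^ 2) := by
  have hπ := Real.pi_pos
  -- These parameters give terms of norm `exp(-κk² + 2κsk)`; the factor `exp(-κs²)` below completes
  -- the square.
  have h := (summable_jacobiTheta₂_term_iff (-Complex.I * (κ * s / Real.pi : ℝ))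
    (Complex.I * (κ / Real.pi : ℝ))).2 (by
      rw [Complex.I_mul_im, Complex.ofReal_re]; positivity)
  refine (h.norm.mul_left (Real.exp (-κ * s ^ 2))).congr fun k => ?_
  rw [norm_jacobiTheta₂_term, ← Real.exp_add]
  congr 1
  simp only [Complex.I_mul_im, Complex.ofReal_re, neg_mul, Complex.neg_im]
  field_simp
  ring

theorem tendsto_gaussianTheta_zero : Tendsto (fun κ => gaussianTheta κ 0) atTop (𝓝 1) := by
  have hs := summable_exp_neg_mul_int_sub_sq one_pos 0
  have h := tendsto_tsum_of_dominated_convergence (𝓕 := atTop)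
    (f := fun (κ : ℝ) (k : ℤ) => Real.exp (-κ * (k - (0 : ℝ)) ^ 2))
    (g := fun k : ℤ => if k = 0 then (1 : ℝ) else 0) hs (fun k => ?_) ?_
  · simpa [gaussianTheta] using h
  · by_cases hk : k = 0
    · simp [hk]
    · simp only [hk, if_false, sub_zero]
      refine Real.tendsto_exp_atBot.comp ?_
      have : (0 : ℝ) < (k : ℝ) ^ 2 := by positivity
      simp only [neg_mul]
      exact tendsto_neg_atTop_atBot.comp (tendsto_id.atTop_mul_const this)
  · filter_upwards [eventually_ge_atTop 1] with κ hκ k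
    rw [Real.norm_of_nonneg (Real.exp_pos _).le]
    gcongr

/-- Summing the theta series over the shifts `r / p` gives the theta series of `ℤ / p`. -/
theorem sum_gaussianTheta_zmod (p : ℕ) [NeZero p] {κ : ℝ} (hκ : 0 < κ) :
    ∑ r : ZMod p, gaussianTheta κ (r.val / p) = gaussianTheta (κ / (p : ℝ) ^ 2) 0 := by
  have hp : (0 : ℝ) < p := by exact_mod_cast Nat.pos_of_ne_zero (NeZero.ne p)
  have hpz : (p : ℤ) ≠ 0 := by exact_mod_cast NeZero.ne p
  -- Division with remainder, with the quotient negated: `z = r - p k` gives `z²/p² = (k - r/p)²`.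
  let e : ℤ ≃ ZMod p × ℤ :=
    { toFun := fun z => ((z : ZMod p), -(z / p))
      invFun := fun q => (q.1.val : ℤ) - p * q.2
      left_inv := fun z => by
        have := Int.emod_add_mul_ediv z p
        simp only [ZMod.val_intCast]
        linarith
      right_inv := fun q => by
        refine Prod.ext (by simp) ?_
        have h1 : (q.1.val : ℤ) / p = 0 :=
          Int.ediv_eq_zero_of_lt (by positivity) (by exact_mod_cast ZMod.val_lt q.1)
        simp only
        rw [sub_eq_add_neg, ← mul_neg, Int.add_mul_ediv_left _ _ hpz, h1]
        ring }
  have hκ' : 0 < κ / (p : ℝ) ^ 2 := by positivity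
  have hs := e.symm.summable_iff.2 (summable_exp_neg_mul_int_sub_sq hκ' 0)
  unfold gaussianTheta
  rw [← e.symm.tsum_eq]
  refine Eq.trans ?_ hs.tsum_prod.symm
  rw [tsum_fintype]
  refine Finset.sum_congr rfl fun r _ => tsum_congr fun k => ?_
  simp only [e, Function.comp_apply, Equiv.coe_fn_symm_mk]
  congr 1
  push_cast
  field_simp
  ring

/-- Poisson summation for a one-dimensional Gaussian twisted by a character. -/
theorem tsum_character_mul_gaussian {σ a : ℝ} (hσ : 0 < σ) (ha : 0 < a) (x s : ℝ) :
    ∑' m : ℤ, Complex.exp (2 * Real.pi * Complex.I * (s * m : ℝ)) *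
        (Real.exp (-(x - a * m) ^ 2 / (2 * σ ^ 2)) : ℂ) =
      (Real.sqrt (2 * Real.pi) * σ / a : ℝ) * ∑' k : ℤ,
        (Real.exp (-(2 * Real.pi ^ 2 * σ ^ 2 / a ^ 2) * (k - s) ^ 2) : ℂ) *
          Complex.exp ((-(2 * Real.pi * x / a * (k - s)) : ℝ) * Complex.I) := by
  have hπ := Real.pi_pos
  set τ : ℝ := a ^ 2 / (2 * Real.pi * σ ^ 2) with hτ
  have hτ0 : 0 < τ := by positivity
  -- The cross term of the square and the character combine into one complex linear coefficient.
  have h := Complex.tsum_exp_neg_quadratic (a := (τ : ℂ)) (by simpa using hτ0)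
    ((a * x / (2 * Real.pi * σ ^ 2) : ℝ) + Complex.I * s)
  have hL : ∀ m : ℤ, Complex.exp (2 * Real.pi * Complex.I * (s * m : ℝ)) *
        (Real.exp (-(x - a * m) ^ 2 / (2 * σ ^ 2)) : ℂ) =
      Complex.exp (-(x ^ 2 / (2 * σ ^ 2)) : ℝ) * Complex.exp (-Real.pi * τ * m ^ 2 +
        2 * Real.pi * ((a * x / (2 * Real.pi * σ ^ 2) : ℝ) + Complex.I * s) * m) := by
    intro m
    rw [Complex.ofReal_exp, ← Complex.exp_add, ← Complex.exp_add, hτ]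
    congr 1
    have h1 : (σ : ℂ) ≠ 0 := by exact_mod_cast hσ.ne'
    have h2 : (Real.pi : ℂ) ≠ 0 := by exact_mod_cast hπ.ne'
    push_cast
    field_simp
    ring
  have hR : ∀ k : ℤ, Complex.exp (-(x ^ 2 / (2 * σ ^ 2)) : ℝ) *
      Complex.exp (-Real.pi / τ * (k + Complex.I *
        ((a * x / (2 * Real.pi * σ ^ 2) : ℝ) + Complex.I * s)) ^ 2) =
      (Real.exp (-(2 * Real.pi ^ 2 * σ ^ 2 / a ^ 2) * (k - s) ^ 2) : ℂ) *
          Complex.exp ((-(2 * Real.pi * x / a * (k - s)) : ℝ) * Complex.I) := by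
    intro k
    rw [Complex.ofReal_exp, ← Complex.exp_add, ← Complex.exp_add, hτ]
    congr 1
    have h1 : (σ : ℂ) ≠ 0 := by exact_mod_cast hσ.ne'
    have h2 : (Real.pi : ℂ) ≠ 0 := by exact_mod_cast hπ.ne'
    have h3 : (a : ℂ) ≠ 0 := by exact_mod_cast ha.ne'
    have hI : Complex.I * ((a * x / (2 * Real.pi * σ ^ 2) : ℝ) + Complex.I * s) =
      Complex.I * (a * x / (2 * Real.pi * σ ^ 2) : ℝ) - s := by
      rw [mul_add, ← mul_assoc, Complex.I_mul_I]; ring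
    rw [hI]
    have hsq : ((k : ℂ) + (Complex.I * (a * x / (2 * Real.pi * σ ^ 2) : ℝ) - s)) ^ 2 =
      (k - s) ^ 2 + 2 * Complex.I * (k - s) * (a * x / (2 * Real.pi * σ ^ 2) : ℝ) -
        (a * x / (2 * Real.pi * σ ^ 2) : ℝ) ^ 2 := by
      have := Complex.I_sq
      linear_combination ((a * x / (2 * Real.pi * σ ^ 2) : ℝ) : ℂ) ^ 2 * this
    rw [hsq]
    push_cast
    field_simp
    ring
  have hsqrt : (1 : ℂ) / (τ : ℂ) ^ (1 / 2 : ℂ) = (Real.sqrt (2 * Real.pi) * σ / a : ℝ) := by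
    have : ((1 / 2 : ℝ) : ℂ) = (1 / 2 : ℂ) := by push_cast; rfl
    rw [← this, ← Complex.ofReal_cpow hτ0.le, ← Real.sqrt_eq_rpow, hτ,
      Real.sqrt_div (by positivity), Real.sqrt_sq ha.le, Real.sqrt_mul (by positivity),
      Real.sqrt_sq hσ.le]
    push_cast
    rw [one_div_div]
  simp_rw [hL]
  rw [tsum_mul_left, h, hsqrt, mul_left_comm, ← tsum_mul_left]
  simp_rw [hR]

theorem summable_norm_character_mul_gaussian {σ a : ℝ} (hσ : 0 < σ) (ha : 0 < a) (x s : ℝ) :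
    Summable fun m : ℤ => ‖Complex.exp (2 * Real.pi * Complex.I * (s * m : ℝ)) *
        (Real.exp (-(x - a * m) ^ 2 / (2 * σ ^ 2)) : ℂ)‖ := by
  have hκ : 0 < a ^ 2 / (2 * σ ^ 2) := by positivity
  refine (summable_exp_neg_mul_int_sub_sq hκ (x / a)).congr fun m => ?_
  have : (2 * Real.pi * Complex.I * (s * m : ℝ) : ℂ) = (2 * Real.pi * (s * m) : ℝ) * Complex.I := by
    push_cast; ring
  rw [norm_mul, this, Complex.norm_exp_ofReal_mul_I, one_mul, Complex.norm_real,
    Real.norm_of_nonneg (Real.exp_pos _).le]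
  congr 1
  field_simp
  ring

/-- The one-dimensional Gaussian sum over `a ℤ` twisted by a character and normalised to have
mean one in the untwisted case. -/
noncomputable def twistedGaussian (σ a x s : ℝ) : ℂ :=
  (a / (Real.sqrt (2 * Real.pi) * σ) : ℝ) * ∑' m : ℤ,
    Complex.exp (2 * Real.pi * Complex.I * (s * m : ℝ)) *
      (Real.exp (-(x - a * m) ^ 2 / (2 * σ ^ 2)) : ℂ)

theorem twistedGaussian_eq {σ a : ℝ} (hσ : 0 < σ) (ha : 0 < a) (x s : ℝ) :
    twistedGaussian σ a x s = ∑' k : ℤ,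
      (Real.exp (-(2 * Real.pi ^ 2 * σ ^ 2 / a ^ 2) * (k - s) ^ 2) : ℂ) *
        Complex.exp ((-(2 * Real.pi * x / a * (k - s)) : ℝ) * Complex.I) := by
  have hπ := Real.pi_pos
  have : 0 < Real.sqrt (2 * Real.pi) := by positivity
  rw [twistedGaussian, tsum_character_mul_gaussian hσ ha, ← mul_assoc, ← Complex.ofReal_mul]
  have : a / (Real.sqrt (2 * Real.pi) * σ) * (Real.sqrt (2 * Real.pi) * σ / a) = 1 := by field_simp
  rw [this, Complex.ofReal_one, one_mul]

theorem twistedGaussian_zero {σ a : ℝ} (hσ : 0 < σ) (ha : 0 < a) (s : ℝ) :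
    twistedGaussian σ a 0 s = gaussianTheta (2 * Real.pi ^ 2 * σ ^ 2 / a ^ 2) s := by
  rw [twistedGaussian_eq hσ ha, gaussianTheta, Complex.ofReal_tsum]
  simp

theorem norm_twistedGaussian_le {σ a : ℝ} (hσ : 0 < σ) (ha : 0 < a) (x s : ℝ) :
    ‖twistedGaussian σ a x s‖ ≤ gaussianTheta (2 * Real.pi ^ 2 * σ ^ 2 / a ^ 2) s := by
  have hκ : 0 < 2 * Real.pi ^ 2 * σ ^ 2 / a ^ 2 := by have := Real.pi_pos; positivity
  rw [twistedGaussian_eq hσ ha]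
  refine tsum_of_norm_bounded (summable_exp_neg_mul_int_sub_sq hκ s).hasSum fun k => ?_
  rw [norm_mul, Complex.norm_exp_ofReal_mul_I, mul_one, Complex.norm_real,
    Real.norm_of_nonneg (Real.exp_pos _).le]

/-- The frequency `k = 0` contributes exactly 1, and the triangle inequality applies to the rest.
The trivial character needs this form because the flatness factor subtracts 1. -/
theorem norm_twistedGaussian_sub_one_le {σ a : ℝ} (hσ : 0 < σ) (ha : 0 < a) (x : ℝ) :
    ‖twistedGaussian σ a x 0 - 1‖ ≤ gaussianTheta (2 * Real.pi ^ 2 * σ ^ 2 / a ^ 2) 0 - 1 := by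
  have hκ : 0 < 2 * Real.pi ^ 2 * σ ^ 2 / a ^ 2 := by have := Real.pi_pos; positivity
  have hs := summable_exp_neg_mul_int_sub_sq hκ 0
  have hn : ∀ k : ℤ, ‖(Real.exp (-(2 * Real.pi ^ 2 * σ ^ 2 / a ^ 2) * (k - (0 : ℝ)) ^ 2) : ℂ) *
        Complex.exp ((-(2 * Real.pi * x / a * (k - (0 : ℝ))) : ℝ) * Complex.I)‖ =
      Real.exp (-(2 * Real.pi ^ 2 * σ ^ 2 / a ^ 2) * (k - (0 : ℝ)) ^ 2) := fun k => by
    rw [norm_mul, Complex.norm_exp_ofReal_mul_I, mul_one, Complex.norm_real,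
      Real.norm_of_nonneg (Real.exp_pos _).le]
  have hs' := Summable.of_norm (hs.congr fun k => (hn k).symm)
  rw [twistedGaussian_eq hσ ha, hs'.tsum_eq_add_tsum_ite 0, gaussianTheta,
    hs.tsum_eq_add_tsum_ite 0]
  simp only [Int.cast_zero, sub_self, ne_eq, OfNat.ofNat_ne_zero, not_false_eq_true, zero_pow,
    mul_zero, Real.exp_zero, neg_zero, Complex.ofReal_one, Complex.ofReal_zero, zero_mul,
    Complex.exp_zero, mul_one, add_sub_cancel_left]
  refine tsum_of_norm_bounded (Summable.hasSum ?_) fun k => ?_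
  · refine Summable.of_nonneg_of_le (fun k => ?_) (fun k => ?_) hs
    · split_ifs <;> positivity
    · split_ifs <;> first | positivity | exact le_rfl
  · split_ifs
    · simp
    · exact (hn k).le

/-- The theta transformation formula. -/
theorem gaussianTheta_zero_transform {κ : ℝ} (hκ : 0 < κ) :
    gaussianTheta κ 0 = Real.sqrt (Real.pi / κ) * gaussianTheta (Real.pi ^ 2 / κ) 0 := by
  have hπ := Real.pi_pos
  have h := Real.tsum_exp_neg_mul_int_sq (a := κ / Real.pi) (by positivity)
  rw [← Real.sqrt_eq_rpow, one_div, ← Real.sqrt_inv, inv_div] at h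
  simp only [gaussianTheta, sub_zero]
  convert h using 5
  · field_simp
  · field_simp

/-! ### Products over coordinates -/

/-- Induction through `FG - 1 = F(G - 1) + (F - 1)`. The bound is an equality when `f = g ≥ 1`, so
nothing is lost in computing the flatness factor exactly. -/
theorem norm_prod_sub_one_le {ι : Type*} (s : Finset ι) (f : ι → ℂ) (g : ι → ℝ)
    (h : ∀ i ∈ s, ‖f i - 1‖ ≤ g i - 1) : ‖∏ i ∈ s, f i - 1‖ ≤ ∏ i ∈ s, g i - 1 := by
  classical
  induction s using Finset.induction_on with
  | empty => simp
  | insert i s hi ih =>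
    have h1 := h i (Finset.mem_insert_self i s)
    have h2 := ih fun j hj => h j (Finset.mem_insert_of_mem hj)
    rw [Finset.prod_insert hi, Finset.prod_insert hi]
    have h3 : ‖f i‖ ≤ g i := by
      have := norm_add_le (f i - 1) 1
      simp only [sub_add_cancel, norm_one] at this
      linarith
    calc ‖f i * ∏ j ∈ s, f j - 1‖ = ‖f i * (∏ j ∈ s, f j - 1) + (f i - 1)‖ := by ring_nf
      _ ≤ ‖f i‖ * ‖∏ j ∈ s, f j - 1‖ + ‖f i - 1‖ := by
        rw [← norm_mul]; exact norm_add_le _ _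
      _ ≤ g i * (∏ j ∈ s, g j - 1) + (g i - 1) := by
        have := (norm_nonneg (f i)).trans h3
        gcongr
      _ = _ := by ring

/-- A product of absolutely convergent series expands as an absolutely convergent series over
tuples. -/
theorem summable_norm_prod_and_tsum_prod {β : Type*} :
    ∀ {n : ℕ} (f : Fin n → β → ℂ), (∀ i, Summable fun b => ‖f i b‖) →
      (Summable fun v : Fin n → β => ‖∏ i, f i (v i)‖) ∧
        ∑' v : Fin n → β, ∏ i, f i (v i) = ∏ i, ∑' b, f i b
  | 0, f, _ => by
    refine ⟨Summable.of_finite, ?_⟩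
    simp [tsum_fintype]
  | n + 1, f, hf => by
    obtain ⟨h1, h2⟩ := summable_norm_prod_and_tsum_prod (fun i => f i.succ) fun i => hf i.succ
    let e : β × (Fin n → β) ≃ (Fin (n + 1) → β) := Fin.consEquiv fun _ => β
    have he : ∀ q : β × (Fin n → β),
        ∏ i, f i (e q i) = f 0 q.1 * ∏ i : Fin n, f i.succ (q.2 i) := fun q => by
      rw [Fin.prod_univ_succ]
      simp [e, Fin.consEquiv]
    constructor
    · rw [← e.summable_iff]
      refine ((hf 0).mul_norm h1).congr fun q => ?_
      simp only [Function.comp_apply, he]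
    · rw [← e.tsum_eq, Fin.prod_univ_succ, ← h2, tsum_mul_tsum_of_summable_norm (hf 0) h1]
      simp only [he]

/-! ### Lattices with one parity check and their volume -/

/-- The linear code of codimension at most one with parity check vector `u`. -/
def parityCode {n p : ℕ} (u : Fin n → ZMod p) : Submodule (ZMod p) (Fin n → ZMod p) :=
  LinearMap.ker (∑ i, u i • LinearMap.proj i : (Fin n → ZMod p) →ₗ[ZMod p] ZMod p)

theorem mem_parityCode {n p : ℕ} (u v : Fin n → ZMod p) :
    v ∈ parityCode u ↔ ∑ i, u i * v i = 0 := by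
  simp [parityCode, LinearMap.sum_apply]

/-- The embedding `v ↦ a v` of `ℤⁿ` in Euclidean space. -/
def scaleInt (n : ℕ) (a : ℝ) : (Fin n → ℤ) →+ EuclideanSpace ℝ (Fin n) where
  toFun v := WithLp.toLp 2 fun i => a * (v i : ℝ)
  map_zero' := by ext i; simp
  map_add' v w := by ext i; simp [mul_add]

@[simp]
theorem scaleInt_apply {n : ℕ} (a : ℝ) (v : Fin n → ℤ) (i : Fin n) :
    scaleInt n a v i = a * (v i : ℝ) := rfl

theorem scaleInt_injective {n : ℕ} {a : ℝ} (ha : a ≠ 0) : Function.Injective (scaleInt n a) := by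
  intro v w h
  funext i
  have := congrArg (fun x : EuclideanSpace ℝ (Fin n) => x i) h
  simpa [ha] using this

theorem mem_constructionA_iff {n p : ℕ} (C : Submodule (ZMod p) (Fin n → ZMod p)) (a : ℝ)
    (x : EuclideanSpace ℝ (Fin n)) :
    x ∈ constructionA p C a ↔
      ∃ v : Fin n → ℤ, (fun i => (v i : ZMod p)) ∈ C ∧ scaleInt n a v = x := by
  change (∃ v : Fin n → ℤ, _ ∧ ∀ i, x i = a * (v i : ℝ)) ↔ _
  refine exists_congr fun v => and_congr_right fun _ => ⟨fun h => ?_, fun h i => ?_⟩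
  · ext i; simp [h i]
  · rw [← h, scaleInt_apply]

theorem scaleInt_mem_constructionA_iff {n p : ℕ} (C : Submodule (ZMod p) (Fin n → ZMod p)) {a : ℝ}
    (ha : a ≠ 0) (v : Fin n → ℤ) :
    scaleInt n a v ∈ constructionA p C a ↔ (fun i => (v i : ZMod p)) ∈ C := by
  rw [mem_constructionA_iff]
  refine ⟨?_, fun h => ⟨v, h, rfl⟩⟩
  rintro ⟨w, hw, h⟩
  rwa [← scaleInt_injective ha h]

/-- A sum over a Construction A lattice as a sum over `ℤⁿ`. -/
theorem tsum_constructionA {n p : ℕ} (C : Submodule (ZMod p) (Fin n → ZMod p)) {a : ℝ}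
    (ha : a ≠ 0) (f : EuclideanSpace ℝ (Fin n) → ℝ) :
    ∑' l : constructionA p C a, f l =
      ∑' v : Fin n → ℤ, {v : Fin n → ℤ | (fun i => (v i : ZMod p)) ∈ C}.indicator
        (fun v => f (scaleInt n a v)) v := by
  rw [← tsum_subtype]
  let φ : {v : Fin n → ℤ | (fun i => (v i : ZMod p)) ∈ C} → constructionA p C a := fun v =>
    ⟨scaleInt n a v, (scaleInt_mem_constructionA_iff C ha v).2 v.2⟩
  have hφ : Function.Bijective φ := by
    constructor
    · intro v w h
      exact Subtype.ext (scaleInt_injective ha (congrArg Subtype.val h))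
    · rintro ⟨x, hx⟩
      obtain ⟨v, hv, rfl⟩ := (mem_constructionA_iff C a x).1 hx
      exact ⟨⟨v, hv⟩, rfl⟩
  exact ((Equiv.ofBijective φ hφ).tsum_eq _).symm

/-- The standard basis of Euclidean space scaled by `a`. -/
noncomputable def scaledBasis (n : ℕ) {a : ℝ} (ha : a ≠ 0) :
    Module.Basis (Fin n) ℝ (EuclideanSpace ℝ (Fin n)) :=
  (EuclideanSpace.basisFun (Fin n) ℝ).toBasis.isUnitSMul fun _ => IsUnit.mk0 a ha

theorem mem_span_scaledBasis {n : ℕ} {a : ℝ} (ha : a ≠ 0) (x : EuclideanSpace ℝ (Fin n)) :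
    x ∈ Submodule.span ℤ (Set.range (scaledBasis n ha)) ↔ ∃ v, scaleInt n a v = x := by
  rw [Submodule.mem_span_range_iff_exists_fun]
  refine exists_congr fun v => ?_
  have : ∑ i, v i • scaledBasis n ha i = scaleInt n a v := by
    ext j
    simp only [scaledBasis, Module.Basis.isUnitSMul_apply, OrthonormalBasis.coe_toBasis,
      EuclideanSpace.basisFun_apply, WithLp.ofLp_sum, Finset.sum_apply, PiLp.smul_apply,
      PiLp.single_apply, scaleInt_apply]
    rw [Finset.sum_eq_single j]
    · simp [mul_comm]
    · intro i _ hi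
      simp [hi.symm]
    · simp
  rw [this]

theorem covolume_span_scaledBasis {n : ℕ} {a : ℝ} (ha : 0 < a) :
    ZLattice.covolume (Submodule.span ℤ (Set.range (scaledBasis n ha.ne'))) = a ^ n := by
  classical
  let b₀ := EuclideanSpace.basisFun (Fin n) ℝ
  rw [ZLattice.covolume_eq_measure_fundamentalDomain _ _
    (ZSpan.isAddFundamentalDomain (scaledBasis n ha.ne') volume),
    ZSpan.measureReal_fundamentalDomain _ _ b₀.toBasis,
    measureReal_congr (ZSpan.fundamentalDomain_ae_parallelepiped b₀.toBasis volume),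
    measureReal_def, OrthonormalBasis.coe_toBasis, OrthonormalBasis.volume_parallelepiped,
    scaledBasis, Module.Basis.det_isUnitSMul]
  simp [abs_of_pos ha]

/-- The fundamental volume of the Construction A lattice with one parity check. -/
theorem covolume_constructionA_parityCode {n p : ℕ} (hp : p.Prime) {a : ℝ} (ha : 0 < a)
    {u : Fin n → ZMod p} (hu : u ≠ 0) :
    ZLattice.covolume (constructionA p (parityCode u) a) = a ^ n * p := by
  have : Fact p.Prime := ⟨hp⟩
  have hp0 : (p : ℝ) ≠ 0 := by exact_mod_cast hp.ne_zero
  set L₁ := constructionA p (parityCode u) a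
  set L₂ := Submodule.span ℤ (Set.range (scaledBasis n ha.ne'))
  have hle : L₁ ≤ L₂ := fun x hx => by
    obtain ⟨v, -, h⟩ := (mem_constructionA_iff _ _ _).1 hx
    exact (mem_span_scaledBasis ha.ne' x).2 ⟨v, h⟩
  have : DiscreteTopology L₁ :=
    DiscreteTopology.of_subset (inferInstanceAs (DiscreteTopology L₂)) hle
  -- The inclusion `p L₂ ⊆ L₁` gives `L₁` full rank.
  have hpmem : ∀ x ∈ L₂, (p : ℝ) • x ∈ L₁ := fun x hx => by
    obtain ⟨v, rfl⟩ := (mem_span_scaledBasis ha.ne' x).1 hx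
    refine (mem_constructionA_iff _ _ _).2 ⟨fun i => p * v i, ?_, ?_⟩
    · simp [mem_parityCode]
    · ext i
      simp [mul_left_comm]
  have : IsZLattice ℝ L₁ := ⟨by
    rw [eq_top_iff, ← (scaledBasis n ha.ne').span_eq]
    refine Submodule.span_le.2 ?_
    rintro _ ⟨i, rfl⟩
    have h := hpmem _ (Submodule.subset_span (Set.mem_range_self i))
    have h' := Submodule.smul_mem (Submodule.span ℝ (L₁ : Set (EuclideanSpace ℝ (Fin n))))
      (p : ℝ)⁻¹ (Submodule.subset_span h)
    rwa [inv_smul_smul₀ hp0] at h'⟩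
  -- `L₁` is the image of the kernel of `ψ` and `L₂` that of `ℤⁿ`; as `ψ` is onto, the index is `p`.
  let ψ : (Fin n → ℤ) →+ ZMod p :=
    { toFun := fun v => ∑ i, u i * (v i : ZMod p)
      map_zero' := by simp
      map_add' := fun v w => by simp [mul_add, Finset.sum_add_distrib] }
  have hψ : Function.Surjective ψ := fun r => by
    obtain ⟨j, hj⟩ := Function.ne_iff.1 hu
    obtain ⟨m, hm⟩ := ZMod.intCast_surjective ((u j)⁻¹ * r)
    refine ⟨Pi.single j m, ?_⟩
    change ∑ i, u i * ((Pi.single j m : Fin n → ℤ) i : ZMod p) = r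
    rw [Finset.sum_eq_single j]
    · rw [Pi.single_eq_same, hm, mul_inv_cancel_left₀ hj]
    · intro i _ hi
      simp [Pi.single_eq_of_ne hi]
    · simp
  have h₁ : L₁.toAddSubgroup = ψ.ker.map (scaleInt n a) := by
    ext x
    rw [Submodule.mem_toAddSubgroup, mem_constructionA_iff, AddSubgroup.mem_map]
    refine exists_congr fun v => and_congr_left fun _ => ?_
    rw [mem_parityCode]
    rfl
  have h₂ : L₂.toAddSubgroup = (⊤ : AddSubgroup (Fin n → ℤ)).map (scaleInt n a) := by
    ext x
    rw [Submodule.mem_toAddSubgroup, mem_span_scaledBasis, AddSubgroup.mem_map]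
    simp
  have h := ZLattice.covolume_div_covolume_eq_relIndex' L₁ L₂ hle
  rw [covolume_span_scaledBasis ha, h₁, h₂,
    AddSubgroup.relIndex_map_map_of_injective _ _ (scaleInt_injective ha.ne'),
    AddSubgroup.relIndex_top_right, AddSubgroup.index_ker,
    AddMonoidHom.range_eq_top.2 hψ, AddSubgroup.card_top, Nat.card_zmod,
    div_eq_iff (by positivity)] at h
  rw [h, mul_comm]

/-! ### The flatness factor as a dual theta series -/

theorem gaussianDensity_scaleInt {n : ℕ} (σ a : ℝ) (v : Fin n → ℤ) (x : EuclideanSpace ℝ (Fin n)) :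
    gaussianDensity σ (scaleInt n a v) x =
      1 / (Real.sqrt (2 * Real.pi) * σ) ^ n *
        ∏ i, Real.exp (-(x i - a * v i) ^ 2 / (2 * σ ^ 2)) := by
  rw [gaussianDensity, EuclideanSpace.norm_sq_eq, ← Real.exp_sum, ← Finset.sum_div,
    Finset.sum_neg_distrib]
  simp

theorem AddChar.map_finset_sum {ι A M : Type*} [AddCommMonoid A] [CommMonoid M] (ψ : AddChar A M)
    (s : Finset ι) (f : ι → A) : ψ (∑ i ∈ s, f i) = ∏ i ∈ s, ψ (f i) :=
  map_prod ψ.toMonoidHom (fun i => Multiplicative.ofAdd (f i)) s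

/-- The character expansion of the periodised Gaussian of a lattice with one parity check. -/
theorem covolume_mul_latticeGaussian_parityCode {n p : ℕ} [Fact p.Prime] {σ a : ℝ} (hσ : 0 < σ)
    (ha : 0 < a) {u : Fin n → ZMod p} (hu : u ≠ 0) (x : EuclideanSpace ℝ (Fin n)) :
    ((ZLattice.covolume (constructionA p (parityCode u) a) *
        latticeGaussian (constructionA p (parityCode u) a) σ x : ℝ) : ℂ) =
      ∑ t : ZMod p, ∏ i, twistedGaussian σ a (x i) (((t * u i).val : ℝ) / p) := by
  classical
  have hp : p.Prime := Fact.out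
  have hpi := fun t : ZMod p => summable_norm_prod_and_tsum_prod
    (fun (i : Fin n) (m : ℤ) =>
      Complex.exp (2 * Real.pi * Complex.I * ((((t * u i).val : ℝ) / p) * m : ℝ)) *
        (Real.exp (-(x i - a * m) ^ 2 / (2 * σ ^ 2)) : ℂ))
    fun i => summable_norm_character_mul_gaussian hσ ha (x i) _
  have hchar : ∀ (t : ZMod p) (v : Fin n → ℤ),
      (∏ i, Complex.exp (2 * Real.pi * Complex.I * ((((t * u i).val : ℝ) / p) * v i : ℝ)) *
        (Real.exp (-(x i - a * v i) ^ 2 / (2 * σ ^ 2)) : ℂ)) =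
      ZMod.stdAddChar (t * ∑ i, u i * (v i : ZMod p)) *
        ((∏ i, Real.exp (-(x i - a * v i) ^ 2 / (2 * σ ^ 2)) : ℝ) : ℂ) := by
    intro t v
    rw [Finset.prod_mul_distrib, Finset.mul_sum, AddChar.map_finset_sum, Complex.ofReal_prod]
    congr 1
    refine Finset.prod_congr rfl fun i _ => ?_
    have : t * (u i * (v i : ZMod p)) = (((t * u i).val * v i : ℤ) : ZMod p) := by
      push_cast
      rw [ZMod.natCast_zmod_val, mul_assoc]
    rw [this, ZMod.stdAddChar_coe]
    congr 1
    push_cast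
    ring
  have hterm : ∀ t : ZMod p, ∏ i, twistedGaussian σ a (x i) (((t * u i).val : ℝ) / p) =
      ((a / (Real.sqrt (2 * Real.pi) * σ) : ℝ) : ℂ) ^ n * _ := fun t => by
    unfold twistedGaussian
    rw [Finset.prod_mul_distrib, Finset.prod_const, Finset.card_univ, Fintype.card_fin,
      ← (hpi t).2]
  simp_rw [hterm]
  rw [← Finset.mul_sum, ← Summable.tsum_finsetSum fun t _ => (hpi t).1.of_norm]
  -- Orthogonality: the sum over `t` is `p` on the code and 0 off it; this `p` is the one in the
  -- covolume `aⁿ p`.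
  simp_rw [hchar, ← Finset.sum_mul, AddChar.sum_mulShift _ (ZMod.isPrimitive_stdAddChar p)]
  rw [covolume_constructionA_parityCode hp ha hu, latticeGaussian,
    tsum_constructionA _ ha.ne' fun l => gaussianDensity σ l x]
  rw [← tsum_mul_left, ← tsum_mul_left, Complex.ofReal_tsum]
  refine tsum_congr fun v => ?_
  rw [Set.indicator_apply]
  simp only [Set.mem_ofPred_eq, mem_parityCode, gaussianDensity_scaleInt, ZMod.card]
  split_ifs
  · push_cast
    rw [div_pow]
    ring
  · simp

/-- The theta series `∑_{k} exp(-2π²σ²(k - r/p)²/a²)` attached to a residue `r` modulo `p`. -/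
noncomputable def residueTheta {p : ℕ} (σ a : ℝ) (r : ZMod p) : ℝ :=
  gaussianTheta (2 * Real.pi ^ 2 * σ ^ 2 / a ^ 2) ((r.val : ℝ) / p)

/-- The upper bound is the triangle inequality in the character expansion. It is attained at `x =
0`, where every phase is 1 and all terms are positive. -/
theorem flatnessFactor_parityCode {n p : ℕ} [Fact p.Prime] {σ a : ℝ} (hσ : 0 < σ)
    (ha : 0 < a) {u : Fin n → ZMod p} (hu : u ≠ 0) :
    flatnessFactor (constructionA p (parityCode u) a) σ =
      ∑ t : ZMod p, ∏ i, residueTheta σ a (t * u i) - 1 := by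
  have hκ : 0 < 2 * Real.pi ^ 2 * σ ^ 2 / a ^ 2 := by have := Real.pi_pos; positivity
  have hbound : ∀ x : EuclideanSpace ℝ (Fin n),
      |ZLattice.covolume (constructionA p (parityCode u) a) *
        latticeGaussian (constructionA p (parityCode u) a) σ x - 1| ≤
      ∑ t : ZMod p, ∏ i, residueTheta σ a (t * u i) - 1 := by
    intro x
    rw [← Real.norm_eq_abs, ← Complex.norm_real, Complex.ofReal_sub,
      covolume_mul_latticeGaussian_parityCode hσ ha hu, Complex.ofReal_one,
      -- On both sides `t = 0` is split off and absorbs the `-1`; the other `t` are bounded in norm.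
      ← Finset.add_sum_erase _ _ (Finset.mem_univ (0 : ZMod p)),
      ← Finset.add_sum_erase _ _ (Finset.mem_univ (0 : ZMod p)), add_sub_right_comm,
      add_sub_right_comm]
    refine (norm_add_le _ _).trans (add_le_add ?_ ?_)
    · refine norm_prod_sub_one_le _ _ _ fun i _ => ?_
      simpa [residueTheta] using norm_twistedGaussian_sub_one_le hσ ha (x i)
    · refine (norm_sum_le _ _).trans (Finset.sum_le_sum fun t _ => ?_)
      rw [norm_prod]
      exact Finset.prod_le_prod (fun _ _ => norm_nonneg _) fun i _ =>
        norm_twistedGaussian_le hσ ha _ _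
  have hzero : ZLattice.covolume (constructionA p (parityCode u) a) *
        latticeGaussian (constructionA p (parityCode u) a) σ 0 =
      ∑ t : ZMod p, ∏ i, residueTheta σ a (t * u i) := by
    rw [← Complex.ofReal_inj, covolume_mul_latticeGaussian_parityCode hσ ha hu]
    push_cast
    simp [twistedGaussian_zero hσ ha, residueTheta]
  refine le_antisymm (ciSup_le hbound) ?_
  refine le_trans ?_ (le_ciSup ⟨_, Set.forall_mem_range.2 hbound⟩ 0)
  rw [hzero]
  exact le_abs_self _

/-! ### Averaging over parity checks -/

/-- The mean over nonzero parity checks `u` of the flatness factor of the associated lattice. -/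
noncomputable def meanFlatness (n p : ℕ) (σ a : ℝ) : ℝ :=
  gaussianTheta (2 * Real.pi ^ 2 * σ ^ 2 / a ^ 2) 0 ^ n - 1 +
    ((p : ℝ) - 1) / ((p : ℝ) ^ n - 1) *
      (gaussianTheta (2 * Real.pi ^ 2 * σ ^ 2 / a ^ 2 / (p : ℝ) ^ 2) 0 ^ n -
        gaussianTheta (2 * Real.pi ^ 2 * σ ^ 2 / a ^ 2) 0 ^ n)

/-- Multiplication by the unit `t` permutes the residues, and summing a product over all `u` gives
the `n`th power of the sum over one coordinate. -/
theorem sum_prod_residueTheta {n p : ℕ} [Fact p.Prime] {σ a : ℝ} (hσ : 0 < σ) (ha : 0 < a)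
    {t : ZMod p} (ht : t ≠ 0) :
    ∑ u : Fin n → ZMod p, ∏ i, residueTheta σ a (t * u i) =
      gaussianTheta (2 * Real.pi ^ 2 * σ ^ 2 / a ^ 2 / (p : ℝ) ^ 2) 0 ^ n := by
  have hκ : 0 < 2 * Real.pi ^ 2 * σ ^ 2 / a ^ 2 := by have := Real.pi_pos; positivity
  rw [← sum_gaussianTheta_zmod p hκ, ← Equiv.sum_comp (Equiv.mulLeft₀ t ht), Fintype.sum_pow]
  rfl

/-- The term `t = 0` does not depend on `u`, and each of the `p - 1` others has the same sum over
`u`. An equality of sums over the same set yields both a `u` below the mean and one above it. -/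
theorem sum_flatnessFactor_parityCode {n p : ℕ} [Fact p.Prime] (hn : n ≠ 0) {σ a : ℝ}
    (hσ : 0 < σ) (ha : 0 < a) :
    ∑ u ∈ Finset.univ.erase (0 : Fin n → ZMod p),
        flatnessFactor (constructionA p (parityCode u) a) σ =
      ∑ _u ∈ Finset.univ.erase (0 : Fin n → ZMod p), meanFlatness n p σ a := by
  have hp : p.Prime := Fact.out
  have hp1 : (1 : ℝ) < p := by exact_mod_cast hp.one_lt
  have hpn : (p : ℝ) ^ n - 1 ≠ 0 := (sub_pos.2 (one_lt_pow₀ hp1 hn)).ne'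
  have hcard : ((Finset.univ.erase (0 : Fin n → ZMod p)).card : ℝ) = (p : ℝ) ^ n - 1 := by
    rw [Finset.card_erase_of_mem (Finset.mem_univ _), Finset.card_univ, Fintype.card_fun,
      ZMod.card, Fintype.card_fin, Nat.cast_sub (Nat.one_le_pow _ _ hp.pos)]
    simp
  have hcard' : ((Finset.univ.erase (0 : ZMod p)).card : ℝ) = (p : ℝ) - 1 := by
    rw [Finset.card_erase_of_mem (Finset.mem_univ _), Finset.card_univ, ZMod.card,
      Nat.cast_sub hp.one_le]
    simp
  have h0 : ∀ u : Fin n → ZMod p, ∏ i, residueTheta σ a (0 * u i) =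
      gaussianTheta (2 * Real.pi ^ 2 * σ ^ 2 / a ^ 2) 0 ^ n := fun u => by
    simp [residueTheta]
  have h1 : ∀ t ∈ Finset.univ.erase (0 : ZMod p),
      ∑ u ∈ Finset.univ.erase (0 : Fin n → ZMod p), ∏ i, residueTheta σ a (t * u i) =
        gaussianTheta (2 * Real.pi ^ 2 * σ ^ 2 / a ^ 2 / (p : ℝ) ^ 2) 0 ^ n -
          gaussianTheta (2 * Real.pi ^ 2 * σ ^ 2 / a ^ 2) 0 ^ n := fun t ht => by
    rw [Finset.sum_erase_eq_sub (Finset.mem_univ _),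
      sum_prod_residueTheta hσ ha (Finset.ne_of_mem_erase ht)]
    simp [residueTheta]
  rw [Finset.sum_congr rfl fun u hu =>
    flatnessFactor_parityCode hσ ha (Finset.ne_of_mem_erase hu)]
  rw [Finset.sum_sub_distrib, Finset.sum_comm, ← Finset.add_sum_erase _ _ (Finset.mem_univ 0),
    Finset.sum_congr rfl h1, Finset.sum_congr rfl fun u _ => h0 u]
  simp only [Finset.sum_const, nsmul_eq_mul, hcard, hcard', meanFlatness]
  field_simp
  ring

/-! ### The limit of large `p` at fixed volume -/

theorem tendsto_sub_one_div_pow_sub_one_mul {n : ℕ} (hn : n ≠ 0) :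
    Tendsto (fun p : ℕ => ((p : ℝ) - 1) / ((p : ℝ) ^ n - 1) * (p : ℝ) ^ (n - 1)) atTop (𝓝 1) := by
  have hx : Tendsto (fun p : ℕ => (p : ℝ)⁻¹) atTop (𝓝 0) := tendsto_inv_atTop_nhds_zero_nat
  have h := (hx.const_sub 1).div ((hx.pow n).const_sub 1) (by simp [hn])
  simp only [sub_zero, zero_pow hn, div_one] at h
  refine h.congr' ?_
  filter_upwards [eventually_ge_atTop 2] with p hp
  have hp1 : (1 : ℝ) < p := by exact_mod_cast hp
  have hp0 : (p : ℝ) ≠ 0 := by positivity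
  have hpn : (p : ℝ) ^ n - 1 ≠ 0 := (sub_pos.2 (one_lt_pow₀ hp1 hn)).ne'
  obtain ⟨m, rfl⟩ := Nat.exists_eq_succ_of_ne_zero hn
  have h2 : 1 - (p : ℝ)⁻¹ ^ (m + 1) = ((p : ℝ) ^ (m + 1) - 1) / (p : ℝ) ^ (m + 1) := by
    rw [inv_pow]
    field_simp
  simp only [Pi.div_apply, Nat.succ_eq_add_one, Nat.add_sub_cancel]
  rw [h2]
  field_simp
  ring

/-- Here `a = (V/p)^(1/n)`, so `aⁿ p = V`. As `a → 0`, the theta value at the larger parameter tends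
to 1. The theta transformation turns the other into `a p / (√(2π) σ)` times a theta value that also
tends to 1, because `a p → ∞`. Its `n`th power grows like `p^(n-1)`, which the weight `(p - 1)/(pⁿ -
1)` cancels. -/
theorem tendsto_meanFlatness {n : ℕ} (hn : 2 ≤ n) {σ V : ℝ} (hσ : 0 < σ) (hV : 0 < V) :
    Tendsto (fun p : ℕ => meanFlatness n p σ ((V / p) ^ (n : ℝ)⁻¹)) atTop
      (𝓝 (V / (Real.sqrt (2 * Real.pi) * σ) ^ n)) := by
  have hπ := Real.pi_pos
  have hn0 : n ≠ 0 := by omega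
  have hnR : (2 : ℝ) ≤ n := by exact_mod_cast hn
  have hcast : Tendsto (fun p : ℕ => (p : ℝ)) atTop atTop := tendsto_natCast_atTop_atTop
  have hκ : Tendsto (fun p : ℕ => 2 * Real.pi ^ 2 * σ ^ 2 / ((V / p) ^ (n : ℝ)⁻¹) ^ 2)
      atTop atTop := by
    have h1 : Tendsto (fun p : ℕ => ((p : ℝ) / V) ^ (n : ℝ)⁻¹) atTop atTop :=
      (tendsto_rpow_atTop (by positivity)).comp (hcast.atTop_div_const hV)
    have h2 := ((tendsto_pow_atTop two_ne_zero).comp h1).const_mul_atTop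
      (show 0 < 2 * Real.pi ^ 2 * σ ^ 2 by positivity)
    refine h2.congr fun p => ?_
    simp only [Function.comp_apply]
    rw [← inv_div V (p : ℝ), Real.inv_rpow (by positivity), inv_pow, ← div_eq_mul_inv]
  -- The product equals `V^(1/n) p^(1 - 1/n)`, which diverges only because `n ≥ 2`.
  have hb : Tendsto (fun p : ℕ => (V / p) ^ (n : ℝ)⁻¹ * p) atTop atTop := by
    have he : 0 < 1 - (n : ℝ)⁻¹ := sub_pos.2 (inv_lt_one_of_one_lt₀ (by linarith))
    have h1 := ((tendsto_rpow_atTop he).comp hcast).const_mul_atTop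
      (show 0 < V ^ (n : ℝ)⁻¹ by positivity)
    refine h1.congr' ?_
    filter_upwards [eventually_gt_atTop 0] with p hp
    have hp' : (0 : ℝ) < p := by exact_mod_cast hp
    simp only [Function.comp_apply]
    rw [Real.div_rpow hV.le hp'.le, Real.rpow_sub hp', Real.rpow_one]
    ring
  have hκ' : Tendsto (fun p : ℕ => ((V / p) ^ (n : ℝ)⁻¹ * p) ^ 2 / (2 * σ ^ 2)) atTop atTop :=
    ((tendsto_pow_atTop two_ne_zero).comp hb).atTop_div_const (by positivity)
  have hT := (tendsto_gaussianTheta_zero.comp hκ).pow n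
  have hS := (tendsto_gaussianTheta_zero.comp hκ').pow n
  have hq := tendsto_sub_one_div_pow_sub_one_mul hn0
  have hq0 : Tendsto (fun p : ℕ => ((p : ℝ) - 1) / ((p : ℝ) ^ n - 1)) atTop (𝓝 0) := by
    have hx : Tendsto (fun p : ℕ => (p : ℝ)⁻¹) atTop (𝓝 0) := tendsto_inv_atTop_nhds_zero_nat
    have h := hq.mul (hx.pow (n - 1))
    rw [zero_pow (by omega), mul_zero] at h
    refine h.congr' ?_
    filter_upwards [eventually_gt_atTop 0] with p hp
    have hp' : (p : ℝ) ≠ 0 := by positivity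
    rw [mul_assoc, ← mul_pow, mul_inv_cancel₀ hp', one_pow, mul_one]
  have h := (hT.sub_const 1).add (((hq.mul_const (V / (Real.sqrt (2 * Real.pi) * σ) ^ n)).mul
    hS).sub (hq0.mul hT))
  simp only [one_pow, sub_self, mul_one, zero_add, one_mul, sub_zero] at h
  refine h.congr' ?_
  filter_upwards [eventually_gt_atTop 0] with p hp
  have hp' : (0 : ℝ) < p := by exact_mod_cast hp
  set a := (V / p) ^ (n : ℝ)⁻¹ with ha_def
  have ha : 0 < a := by positivity
  have haV : a ^ n * p = V := by
    rw [ha_def, Real.rpow_inv_natCast_pow (by positivity) hn0]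
    field_simp
  have hsqrt : Real.sqrt (Real.pi / (2 * Real.pi ^ 2 * σ ^ 2 / a ^ 2 / (p : ℝ) ^ 2)) =
      a * p / (Real.sqrt (2 * Real.pi) * σ) := by
    rw [Real.sqrt_eq_iff_mul_self_eq_of_pos (by positivity)]
    have := Real.mul_self_sqrt (show 0 ≤ 2 * Real.pi by positivity)
    rw [div_mul_div_comm, mul_mul_mul_comm (Real.sqrt _), this]
    field_simp
  have harg : Real.pi ^ 2 / (2 * Real.pi ^ 2 * σ ^ 2 / a ^ 2 / (p : ℝ) ^ 2) =
      (a * p) ^ 2 / (2 * σ ^ 2) := by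
    field_simp
  have hSt := gaussianTheta_zero_transform
    (κ := 2 * Real.pi ^ 2 * σ ^ 2 / a ^ 2 / (p : ℝ) ^ 2) (by positivity)
  rw [hsqrt, harg] at hSt
  have hpow : (p : ℝ) ^ n = p * (p : ℝ) ^ (n - 1) := by
    rw [← pow_succ', Nat.sub_add_cancel (by omega)]
  simp only [meanFlatness, Function.comp_apply]
  have hap : (a * p) ^ n = V * (p : ℝ) ^ (n - 1) := by
    rw [mul_pow, hpow, ← haV]
    ring
  rw [hSt, mul_pow (a * p / _), div_pow (a * p), hap]
  ring

/-- Some parity checks do at most, and some at least, as well as the mean value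
`V / (√(2π) σ)ⁿ`, up to an arbitrarily small error. -/
theorem exists_parityCode_flatnessFactor {n : ℕ} (hn : 2 ≤ n) {σ V ε : ℝ} (hσ : 0 < σ)
    (hV : 0 < V) (hε : 0 < ε) :
    ∃ (p : ℕ) (a : ℝ), p.Prime ∧ 0 < a ∧ a ^ n * p = V ∧
      (∃ u : Fin n → ZMod p, u ≠ 0 ∧ flatnessFactor (constructionA p (parityCode u) a) σ ≤
        V / (Real.sqrt (2 * Real.pi) * σ) ^ n + ε) ∧
      ∃ u : Fin n → ZMod p, u ≠ 0 ∧ V / (Real.sqrt (2 * Real.pi) * σ) ^ n - ε ≤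
        flatnessFactor (constructionA p (parityCode u) a) σ := by
  have hn0 : n ≠ 0 := by omega
  have hev := (tendsto_meanFlatness hn hσ hV).eventually (Metric.ball_mem_nhds _ hε)
  obtain ⟨N, hN⟩ := eventually_atTop.1 hev
  obtain ⟨p, hNp, hp⟩ := Nat.exists_infinite_primes N
  have : Fact p.Prime := ⟨hp⟩
  have hp' : (0 : ℝ) < p := by exact_mod_cast hp.pos
  have hmean := hN p hNp
  set a := (V / p) ^ (n : ℝ)⁻¹ with ha_def
  have ha : 0 < a := by positivity
  have haV : a ^ n * p = V := by
    rw [ha_def, Real.rpow_inv_natCast_pow (by positivity) hn0]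
    field_simp
  rw [Real.dist_eq, abs_lt] at hmean
  have : Nonempty (Fin n) := ⟨⟨0, by omega⟩⟩
  have hne : (Finset.univ.erase (0 : Fin n → ZMod p)).Nonempty :=
    ⟨fun _ => 1, Finset.mem_erase.2 ⟨fun h => one_ne_zero (congrFun h ⟨0, by omega⟩),
      Finset.mem_univ _⟩⟩
  have hsum := sum_flatnessFactor_parityCode (n := n) (p := p) hn0 hσ ha
  refine ⟨p, a, hp, ha, haV, ?_, ?_⟩
  · obtain ⟨u, hu, h⟩ := Finset.exists_le_of_sum_le hne hsum.le
    exact ⟨u, Finset.ne_of_mem_erase hu, by linarith⟩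
  · obtain ⟨u, hu, h⟩ := Finset.exists_le_of_sum_le hne hsum.ge
    exact ⟨u, Finset.ne_of_mem_erase hu, by linarith⟩

/-! ### Prescribed volume-to-noise ratio and exponential rates -/

theorem exists_isModPLattice_flatnessFactor {n : ℕ} (hn : 2 ≤ n) {σ γ δ : ℝ} (hσ : 0 < σ)
    (hγ : 0 < γ) (hδ : 0 < δ) :
    (∃ Λ : Submodule ℤ (EuclideanSpace ℝ (Fin n)), IsModPLattice Λ ∧ vnr Λ σ = γ ∧
      flatnessFactor Λ σ ≤ (1 + δ) * (γ / (2 * Real.pi)) ^ ((n : ℝ) / 2)) ∧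
    ∃ Λ : Submodule ℤ (EuclideanSpace ℝ (Fin n)), IsModPLattice Λ ∧ vnr Λ σ = γ ∧
      (1 - δ) * (γ / (2 * Real.pi)) ^ ((n : ℝ) / 2) ≤ flatnessFactor Λ σ := by
  have hπ := Real.pi_pos
  have hn0 : (n : ℝ) ≠ 0 := by positivity
  set V := (γ * σ ^ 2) ^ ((n : ℝ) / 2) with hV_def
  have hV : 0 < V := by positivity
  set M := (γ / (2 * Real.pi)) ^ ((n : ℝ) / 2) with hM_def
  have hM : 0 < M := by positivity
  have hVM : V / (Real.sqrt (2 * Real.pi) * σ) ^ n = M := by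
    have h1 : (Real.sqrt (2 * Real.pi) * σ) ^ n = (2 * Real.pi * σ ^ 2) ^ ((n : ℝ) / 2) := by
      rw [← Real.rpow_natCast, div_eq_mul_inv, mul_comm (n : ℝ), Real.rpow_mul (by positivity)]
      congr 1
      rw [← one_div, ← Real.sqrt_eq_rpow, Real.sqrt_mul (show 0 ≤ 2 * Real.pi by positivity) (σ ^ 2),
        Real.sqrt_sq hσ.le]
    rw [h1, hV_def, hM_def, ← Real.div_rpow (by positivity) (by positivity)]
    congr 1
    field_simp
  -- The additive error `δ M` is a relative error `δ` on the limiting mean `M`.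
  obtain ⟨p, a, hp, ha, haV, ⟨u, hu, h⟩, ⟨w, hw, h'⟩⟩ :=
    exists_parityCode_flatnessFactor hn hσ hV (mul_pos hδ hM)
  have hvnr : ∀ u : Fin n → ZMod p, u ≠ 0 → vnr (constructionA p (parityCode u) a) σ = γ := by
    intro u hu
    rw [vnr, covolume_constructionA_parityCode hp ha hu, haV, hV_def,
      ← Real.rpow_mul (by positivity), div_mul_div_cancel₀' hn0, div_self two_ne_zero,
      Real.rpow_one]
    field_simp
  rw [hVM] at h h'
  exact ⟨⟨_, ⟨p, _, a, hp, ha, rfl⟩, hvnr u hu, by linarith⟩,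
    ⟨_, ⟨p, _, a, hp, ha, rfl⟩, hvnr w hw, by linarith⟩⟩

theorem flatnessFactor_nonneg {n : ℕ} (Λ : Submodule ℤ (EuclideanSpace ℝ (Fin n))) (σ : ℝ) :
    0 ≤ flatnessFactor Λ σ :=
  Real.iSup_nonneg fun _ => abs_nonneg _

theorem rpow_natCast_div_two_eq_exp {x : ℝ} (hx : 0 < x) (n : ℕ) :
    x ^ ((n : ℝ) / 2) = Real.exp (Real.log x / 2 * n) := by
  rw [Real.rpow_def_of_pos hx]
  congr 1
  ring

theorem theorem1 (σ δ : ℝ) (hσ : 0 < σ) (hδ : 0 < δ)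
    (γ : ℕ → ℝ) (hγ : ∀ n, 2 ≤ n → 0 < γ n) :
    (∃ Λ : (n : ℕ) → Submodule ℤ (EuclideanSpace ℝ (Fin n)),
      (∀ n, 2 ≤ n →
        IsModPLattice (Λ n) ∧ vnr (Λ n) σ = γ n ∧
        flatnessFactor (Λ n) σ ≤
          (1 + δ) * (vnr (Λ n) σ / (2 * Real.pi)) ^ ((n : ℝ) / 2)) ∧
      (∀ g : ℝ, g < 2 * Real.pi → (∀ᶠ n in atTop, γ n ≤ g) →
        ∃ c : ℝ, 0 < c ∧
          (fun n : ℕ => flatnessFactor (Λ n) σ) =O[atTop] fun n : ℕ => Real.exp (-c * n))) ∧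
    (∃ Λ' : (n : ℕ) → Submodule ℤ (EuclideanSpace ℝ (Fin n)),
      (∀ n, 2 ≤ n →
        IsModPLattice (Λ' n) ∧ vnr (Λ' n) σ = γ n ∧
        flatnessFactor (Λ' n) σ ≥
          (1 - δ) * (vnr (Λ' n) σ / (2 * Real.pi)) ^ ((n : ℝ) / 2)) ∧
      (∀ g : ℝ, 2 * Real.pi < g → (∀ᶠ n in atTop, g ≤ γ n) →
        ∃ c : ℝ, 0 < c ∧
          (fun n : ℕ => Real.exp (c * n)) =O[atTop] fun n : ℕ => flatnessFactor (Λ' n) σ)) := by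
  have hπ := Real.pi_pos
  constructor
  · have hex : ∀ n, ∃ Λ : Submodule ℤ (EuclideanSpace ℝ (Fin n)), 2 ≤ n →
        IsModPLattice Λ ∧ vnr Λ σ = γ n ∧
          flatnessFactor Λ σ ≤ (1 + δ) * (γ n / (2 * Real.pi)) ^ ((n : ℝ) / 2) := fun n => by
      by_cases hn : 2 ≤ n
      · obtain ⟨Λ, h⟩ := (exists_isModPLattice_flatnessFactor hn hσ (hγ n hn) hδ).1
        exact ⟨Λ, fun _ => h⟩
      -- Nothing is required for `n < 2`, so any lattice serves.
      · exact ⟨⊥, fun h => absurd h hn⟩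
    choose Λ hΛ using hex
    refine ⟨Λ, fun n hn => ?_, fun g hg hev => ?_⟩
    · obtain ⟨h1, h2, h3⟩ := hΛ n hn
      exact ⟨h1, h2, by rwa [h2]⟩
    -- One index with `0 < γ m ≤ g` makes `g` positive, so its logarithm gives the decay rate.
    · obtain ⟨m, hm, hm2⟩ := (hev.and (eventually_ge_atTop 2)).exists
      have hg0 : 0 < g := (hγ m hm2).trans_le hm
      have hx : 0 < g / (2 * Real.pi) := by positivity
      refine ⟨-(Real.log (g / (2 * Real.pi)) / 2), ?_, IsBigO.of_bound (1 + δ) ?_⟩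
      · have := Real.log_neg hx ((div_lt_one (by positivity)).2 hg)
        linarith
      · filter_upwards [hev, eventually_ge_atTop 2] with n hn hn2
        rw [Real.norm_of_nonneg (flatnessFactor_nonneg _ _),
          Real.norm_of_nonneg (Real.exp_pos _).le, neg_neg, ← rpow_natCast_div_two_eq_exp hx]
        have := hγ n hn2
        refine (hΛ n hn2).2.2.trans ?_
        gcongr
  -- Capping `δ` at `1/2` keeps the factor at least `1/2`, so growth follows even when `δ ≥ 1`; this
  -- is also the source of the constant 2 in the final bound.
  · have hδ' : 0 < min δ (1 / 2) := lt_min hδ (by norm_num)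
    have hex : ∀ n, ∃ Λ : Submodule ℤ (EuclideanSpace ℝ (Fin n)), 2 ≤ n →
        IsModPLattice Λ ∧ vnr Λ σ = γ n ∧
          (1 - min δ (1 / 2)) * (γ n / (2 * Real.pi)) ^ ((n : ℝ) / 2) ≤
            flatnessFactor Λ σ := fun n => by
      by_cases hn : 2 ≤ n
      · obtain ⟨Λ, h⟩ := (exists_isModPLattice_flatnessFactor hn hσ (hγ n hn) hδ').2
        exact ⟨Λ, fun _ => h⟩
      · exact ⟨⊥, fun h => absurd h hn⟩
    choose Λ hΛ using hex
    refine ⟨Λ, fun n hn => ?_, fun g hg hev => ?_⟩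
    · obtain ⟨h1, h2, h3⟩ := hΛ n hn
      refine ⟨h1, h2, le_trans ?_ h3⟩
      rw [h2]
      have := hγ n hn
      gcongr
      exact min_le_left _ _
    · have hg0 : 0 < g := by linarith
      have hx : 0 < g / (2 * Real.pi) := by positivity
      refine ⟨Real.log (g / (2 * Real.pi)) / 2, ?_, IsBigO.of_bound 2 ?_⟩
      · have := Real.log_pos ((one_lt_div (by positivity)).2 hg)
        linarith
      · filter_upwards [hev, eventually_ge_atTop 2] with n hn hn2
        rw [Real.norm_of_nonneg (flatnessFactor_nonneg _ _),
          Real.norm_of_nonneg (Real.exp_pos _).le, ← rpow_natCast_div_two_eq_exp hx]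
        have h1 := (hΛ n hn2).2.2
        have h2 : (g / (2 * Real.pi)) ^ ((n : ℝ) / 2) ≤ (γ n / (2 * Real.pi)) ^ ((n : ℝ) / 2) := by
          gcongr
        have h3 : 1 / 2 ≤ 1 - min δ (1 / 2) := by linarith [min_le_right δ (1 / 2)]
        have h4 : 0 < (γ n / (2 * Real.pi)) ^ ((n : ℝ) / 2) := by
          have := hγ n hn2
          positivity
        nlinarith
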